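/- **Conventions.** Languages contain only function symbols (constants allowed), algebras have nonempty universes, and a class of algebras consists of algebras of one common language. For algebras $A, B$, $A \le B$ means that $A$ is a subalgebra of $B$. A class $K$ of algebras is a *universal class* if it is closed under isomorphic copies, subalgebras and ultraproducts, and a *quasivariety* if it is moreover closed under direct products (including the empty one, which is the trivial algebra). $\mathbb{S}$ denotes closure under subalgebras. An $n$-ary *partial function* on $K$ is a family $f=\langle f^A : A\in K\rangle$, where $f^A$ is an $n$-ary partial function on the universe of $A$. It is *defined* by a first-order formula $\varphi(x_1,\dots,x_n,y)$ of the language of $K$, with $n\ge 1$, if for all $A \in K$ and all $a_1,\dots,a_n$ in $A$ there is at most one $b$ with $A\models\varphi(a_1,\dots,a_n,b)$, and for all $b$ in $A$ one has $A \models \varphi(a_1,\dots,a_n,b)$ iff $f^A(a_1,\dots,a_n)$ is defined and equal to $b$. It is an *implicit operation* of $K$ if it is defined by some first-order formula and is preserved by homomorphisms: for every homomorphism $h\colon A\to B$ with $A,B\in K$, if $f^A(a_1,\dots,a_n)$ is defined then $f^B(h(a_1),\dots,h(a_n))$ is defined and equals $h(f^A(a_1,\dots,a_n))$. Let $\mathsf{imp}(K)$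 be the collection of implicit operations of $K$, and $\mathsf{imp}_{pp}(K)$ that of implicit operations defined by a *pp formula*, i.e. one of the form $\exists z_1 \cdots \exists z_m\,\psi$ with $\psi$ a finite (possibly empty) conjunction of equations. Let $\mathsf{ext}_{pp}(K)$ consist of those $f\in\mathsf{imp}_{pp}(K)$ such that for all $A\in K$ and $a_1,\dots,a_n\in A$ there is $B\in K$ with $A\le B$ and $f^B(a_1,\dots,a_n)$ defined. Let $\mathcal F\subseteq \mathsf{ext}_{pp}(K)$ and let $L_{\mathcal F}$ be the language of $K$ expanded with one new function symbol $g_f$, of the arity of $f$, for each $f\in\mathcal F$. Then $K[L_{\mathcal F}]$ is the class of all $L_{\mathcal F}$-algebras whose reduct $A$ to the language of $K$ is in $K$, is such that $f^A$ is total for each $f\in\mathcal F$, and for which each $g_f$ is interpreted as $f^A$. A *pp expansion* of $K$ is a class of the form $M=\mathbb{S}(K[L_{\mathcal F}])$ for such $\mathcal F$ and $L_{\mathcal F}$. Let $M$ be a pp expansion of a universal class $K$; the reducts $A{\upharpoonright}_K$ of the members $A$ of $M$ to the language of $K$ then belong to $K$. An $n$-ary $f\in\mathsf{imp}(K)$ is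 *interpolated in $M$ by a set $T$* of $n$-ary terms of $M$ if for every $A\in M$ and all $a_1,\dots,a_n\in A$ for which $f^{A{\upharpoonright}_K}(a_1,\dots,a_n)$ is defined, there is $t\in T$ with $f^{A{\upharpoonright}_K}(a_1,\dots,a_n)=t^A(a_1,\dots,a_n)$. Likewise, $f\in \mathsf{imp}(M)$ is interpolated by a set $T$ of $n$-ary terms of $M$ if for all $A\in M$, whenever $f^A(a_1,\dots,a_n)$ is defined, it equals $t^A(a_1,\dots,a_n)$ for some $t\in T$. - $M$ is a *Beth companion* of $K$ if every $f\in\mathsf{imp}(K)$ is interpolated in $M$ by a set of terms of $M$. - $M$ has the *strong Beth definability property* if every $f\in\mathsf{imp}(M)$ is interpolated by a set of terms of $M$. - $M$ has the *strong epimorphism surjectivity property* if for every homomorphism $f\colon A\to B$ with $A,B\in M$ and every $b\in B\setminus f[A]$ there are $C\in M$ and homomorphisms $g,h\colon B\to C$ with $g\circ f=h\circ f$ and $g(b)\neq h(b)$. **Theorem.** Let $K$ be a universal class and $M$ a pp expansion of $K$. The following conditions are equivalent: 1. $M$ is a Beth companion of $K$; 2. $M$ has the strong Beth definability property; 3. $M$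 has the strong epimorphism surjectivity property; 4. every member of $\mathsf{imp}_{pp}(K)$ is interpolated in $M$ by a set of terms of $M$. If, in addition, $K$ is a quasivariety, then conditions 1–4 are also equivalent to: 5. every member of $\mathsf{imp}_{pp}(K)$ is interpolated in $M$ by a single term of $M$. -/

import Mathlib

open FirstOrder

universe u

namespace BethComp

/-- An algebra in the (algebraic) language `L`: a nonempty carrier with an `L`-structure. -/
structure Alg (L : FirstOrder.Language.{u, 0}) where
  carrier : Type u
  [str : L.Structure carrier]
  [nonempty : Nonempty carrier]

instance (L : FirstOrder.Language.{u, 0}) : CoeSort (Alg L) (Type u) := ⟨Alg.carrier⟩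

attribute [instance] Alg.str Alg.nonempty

section ClassOperators

variable {L : FirstOrder.Language.{u, 0}}

/-- The direct product of a family of structures, with coordinatewise interpretation. -/
@[reducible]
def piStructure {I : Type u} (A : I → Alg L) : L.Structure (∀ i, A i) where
  funMap s x := fun i => FirstOrder.Language.Structure.funMap s fun k => x k i
  RelMap r x := ∀ i, FirstOrder.Language.Structure.RelMap r fun k => x k i

/-- The direct product of a (possibly empty) family of algebras. -/
def Alg.pi {I : Type u} (A : I → Alg L) : Alg L :=
  letI := piStructure A
  ⟨∀ i, A i⟩

instance {I : Type u} (A : I → Alg L) (U : Ultrafilter I) :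
    Nonempty ((U : Filter I).Product fun i => A i) :=
  ⟨Quotient.mk _ fun i => Classical.choice (A i).nonempty⟩

/-- The ultraproduct of a family of algebras. -/
def Alg.ultraproduct {I : Type u} (A : I → Alg L) (U : Ultrafilter I) : Alg L :=
  ⟨(U : Filter I).Product fun i => A i⟩

/-- The subalgebra of `B` with (nonempty) universe `S`. -/
def Alg.sub (B : Alg L) (S : L.Substructure B) (hS : Nonempty S) : Alg L :=
  ⟨S⟩

/-- Universal classes: closed under isomorphic copies, subalgebras and ultraproducts. -/
structure IsUniversalClass (K : Set (Alg L)) : Prop where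
  iso : ∀ A B : Alg L, A ∈ K → Nonempty (A ≃[L] B) → B ∈ K
  sub : ∀ (B : Alg L) (S : L.Substructure B) (hS : Nonempty S), B ∈ K → B.sub S hS ∈ K
  ultraproduct : ∀ (I : Type u) (A : I → Alg L) (U : Ultrafilter I),
    (∀ i, A i ∈ K) → Alg.ultraproduct A U ∈ K

/-- Quasivarieties: closed under isomorphic copies, subalgebras, direct products
and ultraproducts. -/
structure IsQuasivariety (K : Set (Alg L)) : Prop extends IsUniversalClass K where
  pi : ∀ (I : Type u) (A : I → Alg L), (∀ i, A i ∈ K) → Alg.pi A ∈ K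

/-- All algebras which are, up to isomorphism, subalgebras of members of `K`. -/
def subClass (K : Set (Alg L)) : Set (Alg L) :=
  {A | ∃ B ∈ K, Nonempty (A ↪[L] B)}

end ClassOperators

section ImplicitOperations

variable {L : FirstOrder.Language.{u, 0}}

/-- An `n`-ary partial function on the class `K`: a family, indexed by the members `A` of `K`,
of `n`-ary partial functions on `A`. -/
def PartialFun (K : Set (Alg L)) (n : ℕ) : Type (u + 1) :=
  ∀ A : K, (Fin n → A.1) →. A.1

/-- `A ⊨ φ(a₁, …, aₙ, b)`, where the last variable `y` of `φ(x₁, …, xₙ, y)` is `Sum.inr 0`. -/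
def Holds (A : Alg L) {n : ℕ} (φ : L.Formula (Fin n ⊕ Fin 1)) (a : Fin n → A) (b : A) : Prop :=
  φ.Realize (Sum.elim a fun _ => b)

/-- `φ(x₁, …, xₙ, y)` is functional in `K`; here `n` is required to be positive. -/
def IsFunctional (K : Set (Alg L)) {n : ℕ} (φ : L.Formula (Fin n ⊕ Fin 1)) : Prop :=
  1 ≤ n ∧ ∀ A ∈ K, ∀ (a : Fin n → A) (b c : A), Holds A φ a b → Holds A φ a c → b = c

variable {K : Set (Alg L)} {n : ℕ}

/-- The partial function `f` on `K` is defined by the formula `φ`: `φ` is functional in `K` and,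
for every `A` in `K`, the graph of `f` on `A` is the relation defined by `φ`. -/
def DefinedBy (f : PartialFun K n) (φ : L.Formula (Fin n ⊕ Fin 1)) : Prop :=
  IsFunctional K φ ∧ ∀ (A : K) (a : Fin n → A.1) (b : A.1), b ∈ f A a ↔ Holds A.1 φ a b

/-- `f` is an operation of `K`: it is preserved by homomorphisms between members of `K`. -/
def IsOperation (f : PartialFun K n) : Prop :=
  ∀ (A B : K) (h : A.1 →[L] B.1) (a : Fin n → A.1) (b : A.1),
    b ∈ f A a → h b ∈ f B (h ∘ a)

/-- A primitive positive formula `∃ z₁ … zₘ, t₁ ≈ s₁ ⊓ … ⊓ tₖ ≈ sₖ` (with `k = 0` allowed). -/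
def IsPP {α : Type} (φ : L.Formula α) : Prop :=
  ∃ (m : ℕ) (E : List (L.Term (α ⊕ Fin m) × L.Term (α ⊕ Fin m))),
    φ = ((E.map fun e => e.1 =' e.2).foldr (· ⊓ ·) (⊤ : L.BoundedFormula α m)).exs

variable (K n) in
/-- The `n`-ary implicit operations of `K`. -/
def imp : Set (PartialFun K n) :=
  {f | (∃ φ, DefinedBy f φ) ∧ IsOperation f}

variable (K n) in
/-- The `n`-ary implicit operations of `K` that are defined by primitive positive formulas. -/
def impPP : Set (PartialFun K n) :=
  {f | f ∈ imp K n ∧ ∃ φ, IsPP φ ∧ DefinedBy f φ}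

/-- `f` is extendable: each tuple of a member `A` of `K` is in the domain of `f` in some
extension `B` of `A` in `K`. -/
def IsExtendable (f : PartialFun K n) : Prop :=
  ∀ (A : K) (a : Fin n → A.1), ∃ (B : K) (e : A.1 ↪[L] B.1), (f B (e ∘ a)).Dom

variable (K n) in
/-- The `n`-ary extendable implicit operations of `K` defined by primitive positive formulas. -/
def extPP : Set (PartialFun K n) :=
  {f | f ∈ impPP K n ∧ IsExtendable f}

/-- `f` is interpolated (in its own class `K`) by the set `T` of `n`-ary terms. -/
def InterpolatedBy (f : PartialFun K n) (T : Set (L.Term (Fin n))) : Prop :=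
  ∀ (A : K) (a : Fin n → A.1) (b : A.1), b ∈ f A a → ∃ t ∈ T, b = t.realize a

variable (K) in
/-- Strong Beth definability property. -/
def StrongBeth : Prop :=
  ∀ n, ∀ f ∈ imp K n, ∃ T : Set (L.Term (Fin n)), InterpolatedBy f T

variable (K) in
/-- Strong epimorphism surjectivity property. -/
def StrongES : Prop :=
  ∀ A ∈ K, ∀ B ∈ K, ∀ (f : A →[L] B) (b : B), b ∉ Set.range f →
    ∃ C ∈ K, ∃ g h : B →[L] C, g.comp f = h.comp f ∧ g b ≠ h b

end ImplicitOperations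

section Expansions

variable {L L' : FirstOrder.Language.{u, 0}}

/-- The reduct of an `L'`-algebra along the language inclusion `ι : L → L'`. -/
def Alg.reduct (ι : L →ᴸ L') (A : Alg L') : Alg L :=
  letI := ι.reduct A
  ⟨A⟩

/-- The `n`-ary function symbols of `L'` that do not belong to `L`. -/
def NewSymbols (ι : L →ᴸ L') (n : ℕ) : Type u :=
  {s : L'.Functions n // s ∉ Set.range fun r : L.Functions n => ι.onFunction r}

/-- The class `K[L']`, where `L'` is obtained from `L` by adding exactly one new function symbol
`g f` for each `f` in `F`: all `L'`-algebras whose `L`-reduct `A` is in `K` and is such that each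
`f` in `F` is total on `A` and is the interpretation of `g f`. -/
def expandedClass (ι : L →ᴸ L') (K : Set (Alg L)) (F : ∀ n, Set (PartialFun K n))
    (g : ∀ n, F n ≃ NewSymbols ι n) : Set (Alg L') :=
  {B | ∃ hB : B.reduct ι ∈ K, ∀ (n : ℕ) (f : F n) (a : Fin n → B),
    f.1 ⟨B.reduct ι, hB⟩ a = Part.some (FirstOrder.Language.Structure.funMap (g n f).1 a : B)}

/-- `M` is a primitive positive expansion of `K`. The language of `K` is viewed as a sublanguage
of that of `M` through `ι`. -/
def IsPPExpansion (ι : L →ᴸ L') (K : Set (Alg L)) (M : Set (Alg L')) : Prop :=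
  ι.Injective ∧ ∃ (F : ∀ n, Set (PartialFun K n)) (_ : ∀ n, F n ⊆ extPP K n)
    (g : ∀ n, F n ≃ NewSymbols ι n), M = subClass (expandedClass ι K F g)

/-- The partial function `f` on `K` is interpolated in `M` by the set `T` of `n`-ary terms of `M`.
It is part of the definition that the reducts of the members of `M` belong to `K`. -/
def InterpolatedIn (ι : L →ᴸ L') {K : Set (Alg L)} (M : Set (Alg L')) {n : ℕ}
    (f : PartialFun K n) (T : Set (L'.Term (Fin n))) : Prop :=
  ∀ A ∈ M, ∃ hA : A.reduct ι ∈ K, ∀ (a : Fin n → A) (b : A),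
    b ∈ f ⟨A.reduct ι, hA⟩ a → ∃ t ∈ T, b = t.realize a

/-- `M` is a Beth companion of `K`. -/
def IsBethCompanion (ι : L →ᴸ L') (K : Set (Alg L)) (M : Set (Alg L')) : Prop :=
  IsPPExpansion ι K M ∧
    ∀ n, ∀ f ∈ imp K n, ∃ T : Set (L'.Term (Fin n)), InterpolatedIn ι M f T

end Expansions

end BethComp

/-! The conditions are linked in the cycle 1 → 4 → 3 → 2 → 1, and 4 → 3 is the heart. Let `b` lie
outside the image `X` of `A → B` and suppose that no two homomorphisms into members of `M` separate
it. Embed `B` in some `B'` in `K[L_F]`. Every member of `K` embeds in the reduct of a member of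
`K[L_F]` (`exists_embedding_reduct`), and homomorphisms between such reducts preserve the new
symbols (`exists_hom_of_reduct_hom`). Hence `b` is dominated in `K` too: two homomorphisms from the
reduct of `B'` into a member of `K` that agree on `X` agree at `b`.

By compactness, finitely many equations true in `B'` already force this. Read as a pp formula with
parameters in `X` and output `b`, they define an implicit operation of `K` sending a tuple of `X` to
`b` (`exists_impPP_of_dominated`). By 4 a term computes `b` from that tuple, so `b ∈ X`, a
contradiction.

For 3 → 2, a value outside the subalgebra generated by its arguments would be separated by two
homomorphisms agreeing on them, against preservation. For 2 → 1, implicit operations of `K` restrict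
to `M` through reducts. Over a quasivariety, counterexamples to all single terms combine into one
product, which gives 4 → 5. -/

namespace BethComp

open FirstOrder.Language Filter

/-! ### Maps into ultraproducts, and Łoś's theorem for graphs of operations -/

section Ultraproducts

variable {L : FirstOrder.Language.{u, 0}}

/-- Pointwise maps into the factors which eventually respect each operation induce a homomorphism
into the ultraproduct. -/
def ultraproductHom [L.IsAlgebraic] {I : Type u} (A : I → Alg L) (U : Ultrafilter I)
    {B : Type u} [L.Structure B] (γ : ∀ i, B → A i)
    (hγ : ∀ (n : ℕ) (s : L.Functions n) (x : Fin n → B),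
      ∀ᶠ i in U, γ i (Structure.funMap s x) = Structure.funMap s (γ i ∘ x)) :
    B →[L] Alg.ultraproduct A U where
  toFun b := ((fun i => γ i b : ∀ i, A i) : (U : Filter I).Product fun i => A i)
  map_fun' {n} s x := by
    refine Eq.trans ?_ (Ultraproduct.funMap_cast (u := U) s fun k i => γ i (x k)).symm
    exact Quotient.sound (hγ n s x)
  map_rel' r := isEmptyElim r

theorem ultraproductHom_apply_eq_iff [L.IsAlgebraic] {I : Type u} {A : I → Alg L}
    {U : Ultrafilter I} {B : Type u} [L.Structure B] {γ δ : ∀ i, B → A i}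
    (hγ : ∀ (n : ℕ) (s : L.Functions n) (x : Fin n → B),
      ∀ᶠ i in U, γ i (Structure.funMap s x) = Structure.funMap s (γ i ∘ x))
    (hδ : ∀ (n : ℕ) (s : L.Functions n) (x : Fin n → B),
      ∀ᶠ i in U, δ i (Structure.funMap s x) = Structure.funMap s (δ i ∘ x)) (b c : B) :
    ultraproductHom A U γ hγ b = ultraproductHom A U δ hδ c ↔ ∀ᶠ i in U, γ i b = δ i c :=
  Quotient.eq

/-- The embedding into an ultraproduct induced by embeddings into the factors. -/
noncomputable def ultraproductEmbedding [L.IsAlgebraic] {I : Type u} (A : I → Alg L)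
    (U : Ultrafilter I) {B : Type u} [L.Structure B] (γ : ∀ i, B → A i)
    (hγ : ∀ (n : ℕ) (s : L.Functions n) (x : Fin n → B),
      ∀ᶠ i in U, γ i (Structure.funMap s x) = Structure.funMap s (γ i ∘ x))
    (hinj : ∀ᶠ i in U, Function.Injective (γ i)) :
    B ↪[L] Alg.ultraproduct A U :=
  Embedding.ofInjective (f := ultraproductHom A U γ hγ) fun b c h => by
    obtain ⟨i, hi, hi'⟩ :=
      (((ultraproductHom_apply_eq_iff hγ hγ b c).1 h).and hinj).exists
    exact hi' hi

theorem holds_ultraproduct {I : Type u} (A : I → Alg L) (U : Ultrafilter I) {n : ℕ}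
    (φ : L.Formula (Fin n ⊕ Fin 1)) (a : Fin n → ∀ i, A i) (b : ∀ i, A i) :
    Holds (Alg.ultraproduct A U) φ
        (fun k => (a k : (U : Filter I).Product fun i => A i))
        (b : (U : Filter I).Product fun i => A i) ↔
      ∀ᶠ i in U, Holds (A i) φ (fun k => a k i) (b i) := by
  have h := Ultraproduct.boundedFormula_realize_cast (M := fun i => A i) (u := U) φ
    (Sum.elim a fun _ => b) Fin.elim0
  have e1 : (fun i : Fin n ⊕ Fin 1 =>
      ((Sum.elim a (fun _ => b) i : ∀ i, A i) : (U : Filter I).Product fun i => A i)) =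
      Sum.elim (fun k => (a k : (U : Filter I).Product fun i => A i)) (fun _ => (b : (U : Filter I).Product fun i => A i)) := by
    ext (k | k) <;> rfl
  have e2 : ∀ i, (fun j : Fin n ⊕ Fin 1 => Sum.elim a (fun _ => b) j i) =
      Sum.elim (fun k => a k i) fun _ => b i := by
    intro i; ext (k | k) <;> rfl
  rw [e1] at h
  simp only [e2] at h
  unfold Holds Formula.Realize
  convert! h using 2
  funext i
  congr! 1

end Ultraproducts

/-! ### Closure of universal classes under embeddings and unions of chains -/

section Classes

variable {L : FirstOrder.Language.{u, 0}} {K : Set (Alg L)}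

theorem IsUniversalClass.mem_of_embedding (hK : IsUniversalClass K) {A B : Alg L} (hB : B ∈ K)
    (e : A ↪[L] B) : A ∈ K := by
  have hne : Nonempty e.toHom.range := ⟨e.equivRange (Classical.choice A.nonempty)⟩
  exact hK.iso (B.sub e.toHom.range hne) A (hK.sub B _ hne hB) ⟨e.equivRange.symm⟩

theorem subClass_of_embedding {A B : Alg L} (hB : B ∈ subClass K) (e : A ↪[L] B) :
    A ∈ subClass K := by
  obtain ⟨C, hC, ⟨j⟩⟩ := hB
  exact ⟨C, hC, ⟨j.comp e⟩⟩

theorem subset_subClass : K ⊆ subClass K := fun A hA => ⟨A, hA, ⟨Embedding.refl L A⟩⟩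

/-- The union of a countable chain of members of a universal class belongs to the class. -/
theorem IsUniversalClass.directLimit_mem [L.IsAlgebraic] (hK : IsUniversalClass K) (G : ℕ → Alg L)
    (hG : ∀ n, G n ∈ K) (f : ∀ n, G n ↪[L] G (n + 1)) :
    ∃ D ∈ K, ∃ e : ∀ n, G n ↪[L] D, (∀ n x, e (n + 1) (f n x) = e n x) ∧
      ∀ (k : ℕ) (a : Fin k → D), ∃ n, ∃ b : Fin k → G n, a = e n ∘ b := by
  let F := DirectedSystem.natLERec (L := L) f
  let D := Language.DirectLimit (fun n => (G n : Type u)) F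
  let e : ∀ n, G n ↪[L] D := fun n => Language.DirectLimit.of L ℕ (fun n => (G n : Type u)) F n
  have : Nonempty D := ⟨e 0 (Classical.choice (G 0).nonempty)⟩
  -- The union embeds in an ultraproduct of the chain: a nonprincipal ultrafilter contains every
  -- final segment, so the arbitrary values of `γ n` before stage `n` do not matter.
  let V : Ultrafilter (ULift.{u} ℕ) := (hyperfilter ℕ).map ULift.up
  have hV : ∀ n : ℕ, ∀ᶠ i in (V : Filter (ULift.{u} ℕ)), n ≤ i.down := fun n => by
    have : ∀ᶠ i in (hyperfilter ℕ : Filter ℕ), n ≤ i :=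
      Nat.hyperfilter_le_atTop (eventually_ge_atTop n)
    exact this
  let A : ULift.{u} ℕ → Alg L := fun i => G i.down
  let γ : ∀ n, ∀ i : ULift.{u} ℕ, G n → A i := fun n i x =>
    if h : n ≤ i.down then F n i.down h x else Classical.choice (A i).nonempty
  have hγ : ∀ n i (h : n ≤ i.down), γ n i = F n i.down h := fun n i h => by
    funext x; simp [γ, h]
  have hhom : ∀ n, ∀ (k : ℕ) (s : L.Functions k) (x : Fin k → G n),
      ∀ᶠ i in V, γ n i (Structure.funMap s x) = Structure.funMap s (γ n i ∘ x) := by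
    intro n k s x
    filter_upwards [hV n] with i hi
    rw [hγ n i hi, Embedding.map_fun]
  let j : D ↪[L] Alg.ultraproduct A V := Language.DirectLimit.lift L ℕ (fun n => (G n : Type u)) F
    (fun n => ultraproductEmbedding A V (γ n) (hhom n) (by
      filter_upwards [hV n] with i hi
      rw [hγ n i hi]
      exact (F n i.down hi).injective))
    (by
      intro m n hmn x
      refine (ultraproductHom_apply_eq_iff (hhom n) (hhom n) (F m n hmn x) (F m n hmn x)).2
        (Eventually.of_forall fun _ => rfl) |>.trans ?_
      refine Quotient.sound ?_
      filter_upwards [hV n] with i hi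
      rw [hγ n i hi, hγ m i (hmn.trans hi)]
      exact _root_.DirectedSystem.map_map' (f := fun i j h => F i j h) hmn hi x)
  refine ⟨⟨D⟩, hK.mem_of_embedding (A := ⟨D⟩) (hK.ultraproduct _ A V fun i => hG _) j, e, ?_, ?_⟩
  · intro n x
    have : f n x = F n (n + 1) n.le_succ x := by
      simp only [F, DirectedSystem.coe_natLERec]
      rw [Nat.leRecOn_succ le_rfl, Nat.leRecOn_self]
    rw [this]
    exact Language.DirectLimit.of_f
  · intro k a
    obtain ⟨n, b, h⟩ := Language.DirectLimit.exists_quotient_mk'_sigma_mk'_eq (fun n => (G n : Type u)) F a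
    exact ⟨n, b, h⟩

end Classes

/-! ### Expanding members of `K` by the new operations -/

section Expansions

variable {L L' : FirstOrder.Language.{u, 0}} (ι : L →ᴸ L')

/-- A homomorphism, viewed between reducts. -/
def Alg.reductHom {A B : Alg L'} (f : A →[L'] B) : A.reduct ι →[L] B.reduct ι where
  toFun := f
  map_fun' s x := f.map_fun (ι.onFunction s) x
  map_rel' r x := f.map_rel (ι.onRelation r) x

/-- An embedding, viewed between reducts. -/
def Alg.reductEmbedding {A B : Alg L'} (f : A ↪[L'] B) : A.reduct ι ↪[L] B.reduct ι where
  toFun := f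
  inj' := f.injective
  map_fun' s x := f.map_fun (ι.onFunction s) x
  map_rel' r x := f.map_rel (ι.onRelation r) x

variable {ι} {K : Set (Alg L)} {F : ∀ n, Set (PartialFun K n)} {g : ∀ n, F n ≃ NewSymbols ι n}

theorem IsUniversalClass.reduct_mem (hK : IsUniversalClass K) {A : Alg L'}
    (hA : A ∈ subClass (expandedClass ι K F g)) : A.reduct ι ∈ K := by
  obtain ⟨B, ⟨hB, -⟩, ⟨e⟩⟩ := hA
  exact hK.mem_of_embedding hB (Alg.reductEmbedding ι e)

theorem IsOperation.mem_embedding {n : ℕ} {f : PartialFun K n} (hf : IsOperation f) {A B : K}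
    (e : A.1 ↪[L] B.1) {a : Fin n → A.1} {b : A.1} (h : b ∈ f A a) : e b ∈ f B (e ∘ a) :=
  hf A B e.toHom a b h

theorem IsOperation.dom_embedding {n : ℕ} {f : PartialFun K n} (hf : IsOperation f) {A B : K}
    (e : A.1 ↪[L] B.1) {a : Fin n → A.1} (h : (f A a).Dom) : (f B (e ∘ a)).Dom :=
  Part.dom_iff_mem.2 ⟨_, hf.mem_embedding e (Part.get_mem h)⟩

/-- Homomorphisms between reducts of members of `expandedClass` preserve the new operations. -/
theorem exists_hom_of_reduct_hom [L'.IsAlgebraic] (hF : ∀ n, F n ⊆ extPP K n) {A B : Alg L'}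
    (hA : A ∈ expandedClass ι K F g) (hB : B ∈ expandedClass ι K F g)
    (h : A.reduct ι →[L] B.reduct ι) : ∃ h' : A →[L'] B, ∀ x : A, h' x = h x := by
  refine ⟨⟨fun x : A => h x, ?_, fun r => isEmptyElim r⟩, fun _ => rfl⟩
  intro n s x
  obtain ⟨hA, hA'⟩ := hA
  obtain ⟨hB, hB'⟩ := hB
  by_cases hs : s ∈ Set.range fun r : L.Functions n => ι.onFunction r
  · obtain ⟨r, rfl⟩ := hs
    exact h.map_fun r x
  · obtain ⟨f, rfl⟩ : ∃ f : F n, (g n f).1 = s :=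
      ⟨(g n).symm ⟨s, hs⟩, congrArg Subtype.val ((g n).apply_symm_apply ⟨s, hs⟩)⟩
    have h3 := (hF n f.2).1.1.2 ⟨_, hA⟩ ⟨_, hB⟩ h x (Structure.funMap (g n f).1 x : A)
      (Part.eq_some_iff.1 (hA' n f x))
    exact Part.mem_unique h3 (Part.eq_some_iff.1 (hB' n f (h ∘ x)))

/-- A member of `K` on which all operations of `F` are total is a reduct. -/
theorem exists_expansion [L.IsAlgebraic] (hK : IsUniversalClass K) (hι : ι.Injective)
    (hF : ∀ n, F n ⊆ extPP K n) (D : K)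
    (hD : ∀ (n : ℕ) (f : F n) (a : Fin n → D.1), (f.1 D a).Dom) :
    ∃ B ∈ expandedClass ι K F g, Nonempty (D.1 ↪[L] B.reduct ι) := by
  classical
  let S : L'.Structure D.1 :=
    { funMap := fun {n} s x =>
        if hs : s ∈ Set.range fun r : L.Functions n => ι.onFunction r then
          Structure.funMap hs.choose x
        else (((g n).symm ⟨s, hs⟩).1 D x).get (hD n _ x)
      RelMap := fun {_} _ _ => True }
  let B : Alg L' := @Alg.mk L' D.1 S _
  have hmap : ∀ (n : ℕ) (r : L.Functions n) (x : Fin n → D.1),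
      S.funMap (ι.onFunction r) x = Structure.funMap r x := by
    intro n r x
    have hs : ι.onFunction r ∈ Set.range fun r : L.Functions n => ι.onFunction r := ⟨r, rfl⟩
    change (if hs : _ then _ else _) = _
    rw [dif_pos hs, hι.onFunction hs.choose_spec]
  let e : D.1 ↪[L] B.reduct ι :=
    { toFun := fun x => x
      inj' := fun _ _ h => h
      map_fun' := fun r x => (hmap _ r x).symm
      map_rel' := fun r => isEmptyElim r }
  let e' : B.reduct ι ≃[L] D.1 :=
    { toFun := fun x => x
      invFun := fun x => x
      left_inv := fun _ => rfl
      right_inv := fun _ => rfl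
      map_fun' := fun r x => hmap _ r x
      map_rel' := fun r => isEmptyElim r }
  have hB : B.reduct ι ∈ K := hK.iso _ _ D.2 ⟨e'.symm⟩
  refine ⟨B, ⟨hB, fun n f a => Part.eq_some_iff.2 ?_⟩, ⟨e⟩⟩
  have hval : S.funMap (g n f).1 a = (f.1 D a).get (hD n f a) := by
    change (if hs : _ then _ else _) = _
    rw [dif_neg (g n f).2]
    congr 2
    change ((g n).symm (g n f)).1 D a = f.1 D a
    rw [Equiv.symm_apply_apply]
  -- `f` is indexed by members of `K`, so its value on `D` is carried to the reduct of `B` along the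
  -- identity map `e`.
  have hmem := (hF n f.2).1.1.2.mem_embedding (A := D) (B := ⟨_, hB⟩) e (Part.get_mem (hD n f a))
  rwa [← hval] at hmem

/-- Extendability meets one demand at a time, and values already defined survive further extensions
because embeddings preserve implicit operations. Demands are indexed by new symbols rather than by
partial functions, which keeps the index type in `Type u`, as ultraproducts require. -/
theorem exists_extension_finset (g : ∀ n, F n ≃ NewSymbols ι n)
    (hF : ∀ n, F n ⊆ extPP K n) (C : K)
    (s : Finset (Σ n, NewSymbols ι n × (Fin n → C.1))) :
    ∃ (D : K) (e : C.1 ↪[L] D.1), ∀ p ∈ s, (((g p.1).symm p.2.1).1 D (e ∘ p.2.2)).Dom := by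
  classical
  induction s using Finset.induction_on with
  | empty => exact ⟨C, Embedding.refl L _, by simp⟩
  | insert p s hp ih =>
    obtain ⟨D, e, he⟩ := ih
    obtain ⟨D', e', he'⟩ := (hF _ ((g p.1).symm p.2.1).2).2 D (e ∘ p.2.2)
    refine ⟨D', e'.comp e, fun q hq => ?_⟩
    rcases Finset.mem_insert.1 hq with rfl | hq
    · exact he'
    · exact (hF _ ((g q.1).symm q.2.1).2).1.1.2.dom_embedding e' (he q hq)

/-- Compactness: in an ultraproduct over the finite sets of demands, each demand is met on a large
set of factors, and being a value of `f` is first-order. -/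
theorem exists_extension_tuples [L.IsAlgebraic] (g : ∀ n, F n ≃ NewSymbols ι n)
    (hK : IsUniversalClass K)
    (hF : ∀ n, F n ⊆ extPP K n) (C : K) :
    ∃ (D : K) (e : C.1 ↪[L] D.1), ∀ (n : ℕ) (f : F n) (a : Fin n → C.1),
      (f.1 D (e ∘ a)).Dom := by
  choose D e he using exists_extension_finset g hF C
  let U : Ultrafilter (Finset (Σ n, NewSymbols ι n × (Fin n → C.1))) := Ultrafilter.of atTop
  let A := Alg.ultraproduct (fun s => (D s).1) U
  have hA : A ∈ K := hK.ultraproduct _ _ U fun s => (D s).2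
  refine ⟨⟨A, hA⟩, ultraproductEmbedding (fun s => (D s).1) U (fun s => e s)
    (fun n s x => Eventually.of_forall fun i => (e i).map_fun s x)
    (Eventually.of_forall fun i => (e i).injective), fun n f a => ?_⟩
  classical
  obtain ⟨φ, hφ⟩ := (hF n f.2).1.1.1
  -- The value is arbitrary for those `s` that omit the demand; the ultrafilter ignores them.
  have h : ∀ s, ∃ b : (D s).1, (⟨n, g n f, a⟩ : Σ n, NewSymbols ι n × (Fin n → C.1)) ∈ s →
      Holds (D s).1 φ (e s ∘ a) b := by
    intro s
    by_cases hs : (⟨n, g n f, a⟩ : Σ n, NewSymbols ι n × (Fin n → C.1)) ∈ s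
    · have := he s _ hs
      simp only [Equiv.symm_apply_apply] at this
      exact ⟨_, fun _ => (hφ.2 _ _ _).1 (Part.get_mem this)⟩
    · exact ⟨Classical.choice (D s).1.nonempty, fun h => absurd h hs⟩
  choose b hb using h
  refine Part.dom_iff_mem.2 ⟨((b : ∀ s, (D s).1) : (U : Filter _).Product fun s => (D s).1), ?_⟩
  refine (hφ.2 ⟨A, hA⟩ _ _).2 ?_
  refine (holds_ultraproduct (fun s => (D s).1) U φ (fun k s => e s (a k)) b).2 ?_
  have := Ultrafilter.of_le (atTop : Filter (Finset (Σ n, NewSymbols ι n × (Fin n → C.1))))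
    (eventually_ge_atTop {⟨n, g n f, a⟩})
  filter_upwards [this] with s hs
  exact hb s (hs (Finset.mem_singleton_self _))

/-- Every member of `K` embeds into the reduct of a member of `expandedClass`. -/
theorem exists_embedding_reduct [L.IsAlgebraic] (g : ∀ n, F n ≃ NewSymbols ι n)
    (hK : IsUniversalClass K) (hι : ι.Injective)
    (hF : ∀ n, F n ⊆ extPP K n) {C : Alg L} (hC : C ∈ K) :
    ∃ B ∈ expandedClass ι K F g, Nonempty (C ↪[L] B.reduct ι) := by
  choose D e he using exists_extension_tuples g hK hF
  -- Each stage defines the operations on all tuples of the previous one, so they become total on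
  -- the union.
  let G : ℕ → K := fun n => Nat.rec ⟨C, hC⟩ (fun _ X => D X) n
  obtain ⟨E, hE, j, hj, hj'⟩ := hK.directLimit_mem (fun n => (G n).1) (fun n => (G n).2)
    fun n => e (G n)
  obtain ⟨B, hB, ⟨i⟩⟩ := exists_expansion (g := g) hK hι hF ⟨E, hE⟩ fun k f a => by
    obtain ⟨n, b, rfl⟩ := hj' k a
    have : j n ∘ b = j (n + 1) ∘ (e (G n) ∘ b) := by
      funext x; exact (hj n (b x)).symm
    rw [this]
    exact (hF k f.2).1.1.2.dom_embedding (A := G (n + 1)) (B := ⟨E, hE⟩) (j (n + 1))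
      (he (G n) k f b)
  exact ⟨B, hB, ⟨i.comp (j 0)⟩⟩

end Expansions

/-! ### Primitive positive formulas and compactness -/

section PrimitivePositive

variable {L : FirstOrder.Language.{u, 0}}

theorem _root_.FirstOrder.Language.Term.realize_congr_varFinset {α M : Type*} [DecidableEq α]
    [L.Structure M] (t : L.Term α) {v w : α → M} (h : ∀ x ∈ t.varFinset, v x = w x) :
    t.realize v = t.realize w := by
  induction t with
  | var x => exact h x (by simp [Term.varFinset])
  | func f ts ih =>
    simp only [Term.realize_func]
    congr 1
    funext i
    exact ih i fun x hx => h x (by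
      simp only [Term.varFinset, Finset.mem_biUnion]
      exact ⟨i, Finset.mem_univ i, hx⟩)

/-- The primitive positive formula `∃ z₁ … zₘ, ⋀ E`. -/
def ppFormula {α : Type} {m : ℕ} (E : List (L.Term (α ⊕ Fin m) × L.Term (α ⊕ Fin m))) :
    L.Formula α :=
  ((E.map fun e => e.1 =' e.2).foldr (· ⊓ ·) (⊤ : L.BoundedFormula α m)).exs

theorem realize_ppFormula {α : Type} {m : ℕ} (E : List (L.Term (α ⊕ Fin m) × L.Term (α ⊕ Fin m)))
    {M : Type*} [L.Structure M] (v : α → M) :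
    (ppFormula E).Realize v ↔
      ∃ z : Fin m → M, ∀ e ∈ E, e.1.realize (Sum.elim v z) = e.2.realize (Sum.elim v z) := by
  unfold ppFormula
  rw [BoundedFormula.realize_exs]
  simp only [BoundedFormula.realize_foldr_inf, List.forall_mem_map,
    BoundedFormula.realize_bdEqual]

theorem IsPP.exists_eq {α : Type} {φ : L.Formula α} (h : IsPP φ) :
    ∃ (m : ℕ) (E : List (L.Term (α ⊕ Fin m) × L.Term (α ⊕ Fin m))), φ = ppFormula E := h

theorem isPP_ppFormula {α : Type} {m : ℕ}
    (E : List (L.Term (α ⊕ Fin m) × L.Term (α ⊕ Fin m))) : IsPP (ppFormula E) := ⟨m, E, rfl⟩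

theorem IsPP.realize_hom {α : Type} {φ : L.Formula α} (h : IsPP φ) {M N : Type*} [L.Structure M]
    [L.Structure N] (f : M →[L] N) {v : α → M} (hv : φ.Realize v) : φ.Realize (f ∘ v) := by
  obtain ⟨m, E, rfl⟩ := h.exists_eq
  obtain ⟨z, hz⟩ := (realize_ppFormula E v).1 hv
  refine (realize_ppFormula E _).2 ⟨f ∘ z, fun e he => ?_⟩
  rw [← Sum.comp_elim, HomClass.realize_term, HomClass.realize_term, hz e he]

theorem IsPP.holds_hom {n : ℕ} {φ : L.Formula (Fin n ⊕ Fin 1)} (h : IsPP φ) {A B : Alg L}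
    (f : A →[L] B) {a : Fin n → A} {b : A} (hv : Holds A φ a b) : Holds B φ (f ∘ a) (f b) := by
  have := h.realize_hom f hv
  rwa [Sum.comp_elim] at this

theorem realize_pi {I : Type u} (A : I → Alg L) {α : Type*} (t : L.Term α)
    (v : α → ∀ i, A i) (i : I) :
    (letI := piStructure A; t.realize v) i = t.realize fun x => v x i := by
  induction t with
  | var x => rfl
  | func f ts ih =>
    simp only [Term.realize_func]
    change Structure.funMap f _ = _
    congr 1
    funext k
    exact ih k

/-- Existential witnesses can be chosen coordinatewise. -/
theorem IsPP.holds_pi {n : ℕ} {φ : L.Formula (Fin n ⊕ Fin 1)} (h : IsPP φ) {I : Type u}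
    {A : I → Alg L} {a : Fin n → ∀ i, A i} {b : ∀ i, A i}
    (hv : ∀ i, Holds (A i) φ (fun k => a k i) (b i)) : Holds (Alg.pi A) φ a b := by
  obtain ⟨m, E, rfl⟩ := h.exists_eq
  choose z hz using fun i => (realize_ppFormula E _).1 (hv i)
  refine (realize_ppFormula E _).2 ⟨fun k i => z i k, fun e he => ?_⟩
  funext i
  refine (realize_pi A e.1 _ i).trans (Eq.trans ?_ (realize_pi A e.2 _ i).symm)
  have : (fun x => (Sum.elim (Sum.elim a fun _ => b) (fun k i => z i k) :
      (Fin n ⊕ Fin 1) ⊕ Fin m → ∀ i, A i) x i) =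
      Sum.elim (Sum.elim (fun k => a k i) fun _ => b i) (z i) := by
    funext x; rcases x with (x | x) | x <;> rfl
  change e.1.realize (fun x => (Sum.elim (Sum.elim a fun _ => b) (fun k i => z i k) :
      (Fin n ⊕ Fin 1) ⊕ Fin m → ∀ i, A i) x i) = e.2.realize (fun x =>
      (Sum.elim (Sum.elim a fun _ => b) (fun k i => z i k) :
      (Fin n ⊕ Fin 1) ⊕ Fin m → ∀ i, A i) x i)
  rw [this]
  exact hz i e he

/-- The partial function defined by a functional formula. -/
noncomputable def partialFunOf (K : Set (Alg L)) {n : ℕ} (φ : L.Formula (Fin n ⊕ Fin 1)) :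
    PartialFun K n :=
  fun A a => ⟨∃ b, Holds A.1 φ a b, fun h => h.choose⟩

theorem definedBy_partialFunOf {K : Set (Alg L)} {n : ℕ} {φ : L.Formula (Fin n ⊕ Fin 1)}
    (h : IsFunctional K φ) : DefinedBy (partialFunOf K φ) φ := by
  refine ⟨h, fun A a b => ⟨?_, fun hb => ?_⟩⟩
  · rintro ⟨hd, rfl⟩
    exact hd.choose_spec
  · exact ⟨⟨b, hb⟩, h.2 A.1 A.2 a _ _ (Exists.choose_spec (⟨b, hb⟩ : ∃ b, Holds A.1 φ a b)) hb⟩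

theorem partialFunOf_mem_impPP {K : Set (Alg L)} {n : ℕ} {φ : L.Formula (Fin n ⊕ Fin 1)}
    (h : IsFunctional K φ) (hφ : IsPP φ) : partialFunOf K φ ∈ impPP K n := by
  have hd := definedBy_partialFunOf h
  refine ⟨⟨⟨φ, hd⟩, fun A B f a b hb => ?_⟩, φ, hφ, hd⟩
  exact (hd.2 _ _ _).2 (hφ.holds_hom f ((hd.2 _ _ _).1 hb))

open Classical in
/-- A finite set of equations true in `B` is captured by a primitive positive formula whose
parameters lie in `X ∪ {b}` and whose solutions yield maps satisfying these equations. -/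
theorem exists_isPP_of_equations (B : Alg L) {X : Set B} (hX : X.Nonempty) {b : B} (hb : b ∉ X)
    (s : Finset (L.Term B × L.Term B)) (hs : ∀ e ∈ s, e.1.realize id = e.2.realize id) :
    ∃ (n : ℕ) (_ : 1 ≤ n) (φ : L.Formula (Fin n ⊕ Fin 1)) (x : Fin n → B),
      IsPP φ ∧ (∀ k, x k ∈ X) ∧ Holds B φ x b ∧
      ∀ (C : Alg L) (a : Fin n → C) (c c' : C), Holds C φ a c → Holds C φ a c' →
        ∃ γ δ : B → C, γ b = c ∧ δ b = c' ∧
          (∀ e ∈ s, e.1.realize γ = e.2.realize γ ∧ e.1.realize δ = e.2.realize δ) ∧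
          ∀ e ∈ s, ∀ v ∈ e.1.varFinset, v ∈ X → γ v = δ v := by
  obtain ⟨x₀, hx₀⟩ := hX
  let V : Finset B := s.biUnion fun e => e.1.varFinset ∪ e.2.varFinset
  -- Adding `x₀` makes the arity positive even if no equation mentions `X`.
  let W : Finset B := insert x₀ (V.filter (· ∈ X))
  have hWX : ∀ w ∈ W, w ∈ X := by
    intro w hw
    rcases Finset.mem_insert.1 hw with rfl | hw
    · exact hx₀
    · exact (Finset.mem_filter.1 hw).2
  have hbW : b ∉ W := fun h => hb (hWX b h)
  -- Elements of `W` become arguments, `b` the output, and the rest of `V` bound variables. Elements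
  -- that occur in no equation also fall to the output variable, harmlessly.
  let ρ : B → (Fin W.card ⊕ Fin 1) ⊕ Fin V.card := fun v =>
    if hw : v ∈ W then Sum.inl (Sum.inl (W.equivFin ⟨v, hw⟩))
    else if hv : v ∈ V ∧ v ≠ b then Sum.inr (V.equivFin ⟨v, hv.1⟩)
    else Sum.inl (Sum.inr 0)
  have hρW : ∀ v (hw : v ∈ W), ρ v = Sum.inl (Sum.inl (W.equivFin ⟨v, hw⟩)) := fun v hw => by
    simp only [ρ, dif_pos hw]
  have hρb : ρ b = Sum.inl (Sum.inr 0) := by simp [ρ, hbW]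
  let x : Fin W.card → B := fun k => (W.equivFin.symm k).1
  let z : Fin V.card → B := fun k => (V.equivFin.symm k).1
  have hρV : ∀ v ∈ V, Sum.elim (Sum.elim x fun _ => b) z (ρ v) = v := by
    intro v hv
    by_cases hw : v ∈ W
    · simp [ρ, hw, x]
    · by_cases hvb : v = b
      · subst hvb; simp [hρb]
      · simp [ρ, hw, hv, hvb, z]
  let E : List (L.Term ((Fin W.card ⊕ Fin 1) ⊕ Fin V.card) ×
      L.Term ((Fin W.card ⊕ Fin 1) ⊕ Fin V.card)) :=
    s.toList.map fun e => (e.1.relabel ρ, e.2.relabel ρ)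
  have hE : ∀ (C : Alg L) (a : Fin W.card → C) (c : C), Holds C (ppFormula E) a c ↔
      ∃ y : Fin V.card → C, ∀ e ∈ s,
        e.1.realize (Sum.elim (Sum.elim a fun _ => c) y ∘ ρ) =
          e.2.realize (Sum.elim (Sum.elim a fun _ => c) y ∘ ρ) := by
    intro C a c
    refine (realize_ppFormula E _).trans ?_
    simp only [E, List.forall_mem_map, Finset.mem_toList, Term.realize_relabel]
  refine ⟨W.card, Finset.card_pos.2 ⟨x₀, Finset.mem_insert_self _ _⟩, ppFormula E, x,
    isPP_ppFormula E, fun k => hWX _ (W.equivFin.symm k).2, (hE B x b).2 ⟨z, fun e he => ?_⟩, ?_⟩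
  · have h1 : ∀ t : L.Term B, t.varFinset ⊆ V →
        t.realize (Sum.elim (Sum.elim x fun _ => b) z ∘ ρ) = t.realize id := fun t ht =>
      t.realize_congr_varFinset fun v hv => hρV v (ht hv)
    rw [h1, h1, hs e he]
    · exact fun v hv => Finset.mem_biUnion.2 ⟨e, he, Finset.mem_union_right _ hv⟩
    · exact fun v hv => Finset.mem_biUnion.2 ⟨e, he, Finset.mem_union_left _ hv⟩
  · intro C a c c' hc hc'
    obtain ⟨y, hy⟩ := (hE C a c).1 hc
    obtain ⟨y', hy'⟩ := (hE C a c').1 hc'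
    refine ⟨_, _, ?_, ?_, fun e he => ⟨hy e he, hy' e he⟩, fun e he v hv hvX => ?_⟩
    · simp [hρb]
    · simp [hρb]
    · have hw : v ∈ W := Finset.mem_insert_of_mem (Finset.mem_filter.2
        ⟨Finset.mem_biUnion.2 ⟨e, he, Finset.mem_union_left _ hv⟩, hvX⟩)
      simp [hρW v hw]

/-- If `b` is determined by its values on `X` under homomorphisms into members of `K`, then it is
the value of an implicit operation, defined by a primitive positive formula, at a tuple in `X`. -/
theorem exists_impPP_of_dominated [L.IsAlgebraic] {K : Set (Alg L)} (hK : IsUniversalClass K)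
    (B : K) {X : Set B.1} (hX : X.Nonempty) {b : B.1} (hb : b ∉ X)
    (hdom : ∀ D ∈ K, ∀ γ δ : B.1 →[L] D, (∀ x ∈ X, γ x = δ x) → γ b = δ b) :
    ∃ (n : ℕ) (f : PartialFun K n) (x : Fin n → B.1), f ∈ impPP K n ∧ (∀ k, x k ∈ X) ∧
      b ∈ f B x := by
  classical
  let Diag := {e : L.Term B.1 × L.Term B.1 // e.1.realize id = e.2.realize id}
  by_contra hcon
  -- If the formula of `s` were functional in `K`, it would define the desired operation. So it has
  -- two outputs at one tuple in some member of `K`.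
  have key : ∀ s : Finset Diag, ∃ (C : K) (γ δ : B.1 → C.1), γ b ≠ δ b ∧
      (∀ e ∈ s, e.1.1.realize γ = e.1.2.realize γ ∧ e.1.1.realize δ = e.1.2.realize δ) ∧
      ∀ e ∈ s, ∀ v ∈ e.1.1.varFinset, v ∈ X → γ v = δ v := by
    intro s
    obtain ⟨n, hn, φ, x, hφ, hx, hBx, h⟩ := exists_isPP_of_equations B.1 hX hb
      (s.image Subtype.val) (by
        intro e he
        obtain ⟨e, -, rfl⟩ := Finset.mem_image.1 he
        exact e.2)
    have hfun : ¬ IsFunctional K φ := fun hfun =>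
      hcon ⟨n, partialFunOf K φ, x, partialFunOf_mem_impPP hfun hφ, hx,
        ((definedBy_partialFunOf hfun).2 _ _ _).2 hBx⟩
    simp only [IsFunctional, hn, true_and, not_forall] at hfun
    obtain ⟨C, hC, a, c, c', hc, hc', hne⟩ := hfun
    obtain ⟨γ, δ, rfl, rfl, h1, h2⟩ := h C a c c' hc hc'
    exact ⟨⟨C, hC⟩, γ, δ, hne, fun e he => h1 _ (Finset.mem_image_of_mem _ he),
      fun e he => h2 _ (Finset.mem_image_of_mem _ he)⟩
  choose C γ δ hne heq hX' using key
  let U : Ultrafilter (Finset Diag) := Ultrafilter.of atTop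
  have hU : ∀ e : Diag, ∀ᶠ s in (U : Filter (Finset Diag)), e ∈ s := fun e =>
    Ultrafilter.of_le (atTop : Filter (Finset Diag)) <|
      (eventually_ge_atTop {e}).mono fun s hs => hs (Finset.mem_singleton_self e)
  -- These equations eventually belong to `s`, so `γ` and `δ` become homomorphisms in the
  -- ultraproduct.
  let graph : ∀ (n : ℕ) (f : L.Functions n) (x : Fin n → B.1), Diag := fun n f x =>
    ⟨(Term.var (Structure.funMap f x), Term.func f fun k => Term.var (x k)), rfl⟩
  have hγ : ∀ (n : ℕ) (f : L.Functions n) (x : Fin n → B.1),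
      ∀ᶠ s in U, γ s (Structure.funMap f x) = Structure.funMap f (γ s ∘ x) := fun n f x =>
    (hU (graph n f x)).mono fun s hs => (heq s _ hs).1
  have hδ : ∀ (n : ℕ) (f : L.Functions n) (x : Fin n → B.1),
      ∀ᶠ s in U, δ s (Structure.funMap f x) = Structure.funMap f (δ s ∘ x) := fun n f x =>
    (hU (graph n f x)).mono fun s hs => (heq s _ hs).2
  have := hdom _ (hK.ultraproduct _ (fun s => (C s).1) U fun s => (C s).2)
    (ultraproductHom _ U γ hγ) (ultraproductHom _ U δ hδ) fun x hx =>
      (ultraproductHom_apply_eq_iff hγ hδ x x).2 <|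
        -- The trivial equation `x = x` makes `x` occur in `s`, which forces agreement there.
        (hU ⟨(Term.var x, Term.var x), rfl⟩).mono fun s hs =>
          hX' s _ hs x (by simp [Term.varFinset]) hx
  obtain ⟨s, hs⟩ := ((ultraproductHom_apply_eq_iff hγ hδ b b).1 this).exists
  exact hne s hs

end PrimitivePositive

/-! ### Interpolation, epimorphisms and definability -/

section Interpolation

variable {L L' : FirstOrder.Language.{u, 0}} {ι : L →ᴸ L'} {K : Set (Alg L)}
  {F : ∀ n, Set (PartialFun K n)} {g : ∀ n, F n ≃ NewSymbols ι n}

theorem holds_onFormula (A : Alg L') {n : ℕ} (φ : L.Formula (Fin n ⊕ Fin 1)) (a : Fin n → A)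
    (b : A) : Holds A (ι.onFormula φ) a b ↔ Holds (A.reduct ι) φ a b := by
  let := ι.reduct A
  exact LHom.realize_onFormula (M := A) ι φ

/-- The strong epimorphism surjectivity property implies the strong Beth definability property. -/
theorem StrongES.strongBeth {L : FirstOrder.Language.{u, 0}} {M : Set (Alg L)}
    (hM : ∀ (B : Alg L) (S : L.Substructure B) (hS : Nonempty S), B ∈ M → B.sub S hS ∈ M)
    (h : StrongES M) : StrongBeth M := by
  rintro n f ⟨⟨φ, hφ⟩, hf⟩
  -- With all terms allowed, interpolation says that `b` lies in the subalgebra generated by `a`.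
  refine ⟨Set.univ, fun A a b hb => ?_⟩
  let S := Substructure.closure L (Set.range a)
  have hS : Nonempty S := ⟨⟨a ⟨0, hφ.1.1⟩, Substructure.subset_closure ⟨_, rfl⟩⟩⟩
  have hbS : b ∈ S := by
    by_contra hbS
    obtain ⟨C, hC, γ, δ, hγδ, hne⟩ := h _ (hM A.1 S hS A.2) A.1 A.2
      (S.subtype.toHom : A.1.sub S hS →[L] A.1) b (by
        rintro ⟨x, rfl⟩
        exact hbS x.2)
    have heq : γ ∘ a = δ ∘ a := by
      funext k
      exact DFunLike.congr_fun hγδ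
        (⟨a k, Substructure.subset_closure ⟨k, rfl⟩⟩ : S)
    have h1 := hf A ⟨C, hC⟩ γ a b hb
    have h2 := hf A ⟨C, hC⟩ δ a b hb
    rw [heq] at h1
    exact hne (Part.mem_unique h1 h2)
  obtain ⟨t, ht⟩ := Substructure.mem_closure_iff_exists_term.1 hbS
  choose k hk using fun x : Set.range a => x.2
  refine ⟨t.relabel k, Set.mem_univ _, ?_⟩
  rw [Term.realize_relabel, ← ht]
  congr 1
  funext x
  exact (hk x).symm

/-- Implicit operations of `K` restrict to implicit operations of a class of expansions. -/
theorem StrongBeth.exists_interpolatedIn {M : Set (Alg L')} (hM : ∀ A ∈ M, A.reduct ι ∈ K)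
    (h : StrongBeth M) {n : ℕ} {f : PartialFun K n} (hf : f ∈ imp K n) :
    ∃ T : Set (L'.Term (Fin n)), InterpolatedIn ι M f T := by
  obtain ⟨⟨φ, hφ⟩, hf⟩ := hf
  let f' : PartialFun M n := fun A a => f ⟨A.1.reduct ι, hM A.1 A.2⟩ a
  have hf' : f' ∈ imp M n := by
    refine ⟨⟨ι.onFormula φ, ⟨hφ.1.1, fun A hA a b c hb hc => ?_⟩, fun A a b => ?_⟩,
      fun A B γ a b hb => hf ⟨_, hM A.1 A.2⟩ ⟨_, hM B.1 B.2⟩ (Alg.reductHom ι γ) a b hb⟩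
    · exact hφ.1.2 _ (hM A hA) a b c ((holds_onFormula A φ a b).1 hb)
        ((holds_onFormula A φ a c).1 hc)
    · exact (hφ.2 ⟨_, hM A.1 A.2⟩ a b).trans (holds_onFormula A.1 φ a b).symm
  obtain ⟨T, hT⟩ := h n f' hf'
  exact ⟨T, fun A hA => ⟨hM A hA, fun a b hb => hT ⟨A, hA⟩ a b hb⟩⟩

/-- If the operations in `impPP K` are interpolated by terms of a primitive positive expansion,
then the latter has the strong epimorphism surjectivity property. -/
theorem strongES_of_interpolatedIn [L.IsAlgebraic] [L'.IsAlgebraic] (hK : IsUniversalClass K)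
    (hι : ι.Injective) (hF : ∀ n, F n ⊆ extPP K n)
    (h : ∀ n, ∀ f ∈ impPP K n, ∃ T : Set (L'.Term (Fin n)),
      InterpolatedIn ι (subClass (expandedClass ι K F g)) f T) :
    StrongES (subClass (expandedClass ι K F g)) := by
  rintro A - B ⟨B', hB', ⟨j⟩⟩ f b hb
  by_contra hcon
  obtain ⟨n, p, x, hp, hx, hbx⟩ := exists_impPP_of_dominated hK ⟨B'.reduct ι, hB'.1⟩
    (X := Set.range fun a : A => j (f a)) (Set.range_nonempty _) (b := j b)
    (by
      rintro ⟨a, ha⟩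
      exact hb ⟨a, j.injective ha⟩)
    (by
      intro D hD γ δ hγδ
      obtain ⟨E, hE, ⟨e⟩⟩ := exists_embedding_reduct g hK hι hF hD
      obtain ⟨γ', hγ'⟩ := exists_hom_of_reduct_hom hF hB' hE (e.toHom.comp γ)
      obtain ⟨δ', hδ'⟩ := exists_hom_of_reduct_hom hF hB' hE (e.toHom.comp δ)
      by_contra hne
      refine hcon ⟨E, subset_subClass hE, γ'.comp j.toHom, δ'.comp j.toHom, ?_, ?_⟩
      · ext a
        exact (hγ' _).trans ((congrArg e (hγδ _ ⟨a, rfl⟩)).trans (hδ' _).symm)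
      · intro heq
        exact hne (e.injective ((hγ' (j b)).symm.trans (heq.trans (hδ' (j b))))))
  choose a ha using hx
  obtain ⟨T, hT⟩ := h n p hp
  obtain ⟨_, hT⟩ := hT B' (subset_subClass hB')
  obtain ⟨t, -, ht⟩ := hT x _ hbx
  have hxa : x = j ∘ f ∘ a := funext fun k => (ha k).symm
  rw [hxa] at ht
  refine hb ⟨t.realize a, j.injective ?_⟩
  rw [ht, HomClass.realize_term, HomClass.realize_term]

/-- Operations defined by pp formulas are computed coordinatewise in products, hence stay total
there. -/
theorem expandedClass_pi_mem (hK : IsQuasivariety K) (hF : ∀ n, F n ⊆ extPP K n) {I : Type u}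
    {A : I → Alg L'} (hA : ∀ i, A i ∈ expandedClass ι K F g) :
    Alg.pi A ∈ expandedClass ι K F g := by
  have hred : (Alg.pi A).reduct ι ∈ K := hK.pi I (fun i => (A i).reduct ι) fun i => (hA i).1
  refine ⟨hred, fun n f a => Part.eq_some_iff.2 ?_⟩
  obtain ⟨-, φ, hφ, hφf⟩ := (hF n f.2).1
  refine (hφf.2 ⟨_, hred⟩ _ _).2 ?_
  refine hφ.holds_pi (A := fun i => (A i).reduct ι) fun i => ?_
  exact (hφf.2 ⟨_, (hA i).1⟩ _ _).1 (Part.eq_some_iff.1 ((hA i).2 n f fun k => a k i))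

/-- Over a quasivariety, interpolation by a set of terms yields interpolation by one term. -/
theorem exists_interpolatedIn_singleton (hK : IsQuasivariety K) (hF : ∀ n, F n ⊆ extPP K n)
    {n : ℕ} {f : PartialFun K n} (hf : f ∈ impPP K n) {T : Set (L'.Term (Fin n))}
    (hT : InterpolatedIn ι (subClass (expandedClass ι K F g)) f T) :
    ∃ t : L'.Term (Fin n), InterpolatedIn ι (subClass (expandedClass ι K F g)) f {t} := by
  obtain ⟨⟨-, hop⟩, φ, hφ, hφf⟩ := hf
  by_contra! hcon
  have key : ∀ t : L'.Term (Fin n), ∃ (B : Alg L') (hB : B ∈ expandedClass ι K F g)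
      (a : Fin n → B) (b : B), b ∈ f ⟨B.reduct ι, hB.1⟩ a ∧ b ≠ t.realize a := by
    intro t
    by_contra! ht
    refine hcon t fun A hA => ⟨hK.toIsUniversalClass.reduct_mem hA, fun a b hb => ⟨t, rfl, ?_⟩⟩
    obtain ⟨B, hB, ⟨e⟩⟩ := hA
    have := ht B hB (e ∘ a) (e b)
      (hop.mem_embedding (B := ⟨B.reduct ι, hB.1⟩) (Alg.reductEmbedding ι e) hb)
    rw [HomClass.realize_term] at this
    exact e.injective this
  -- In the product over all terms `t`, any term that interpolates `f` at the combined tuple fails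
  -- at its own coordinate.
  choose B hB a b hb hne using key
  have hP := expandedClass_pi_mem hK hF hB
  obtain ⟨_, h⟩ := hT _ (subset_subClass hP)
  obtain ⟨t, -, ht⟩ := h (fun k i => a i k) b <| (hφf.2 ⟨_, hP.1⟩ _ _).2 <|
    hφ.holds_pi (A := fun t => (B t).reduct ι) fun i => (hφf.2 ⟨_, (hB i).1⟩ _ _).1 (hb i)
  exact hne t ((congrFun ht t).trans (realize_pi B t _ t))

end Interpolation

end BethComp

/-! ### The equivalences -/

theorem mainTheorem8 (L L' : FirstOrder.Language.{u, 0}) [L.IsAlgebraic] [L'.IsAlgebraic]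
    (ι : L →ᴸ L') (K : Set (BethComp.Alg L)) (M : Set (BethComp.Alg L'))
    (hK : BethComp.IsUniversalClass K) (hM : BethComp.IsPPExpansion ι K M) :
    List.TFAE
      [BethComp.IsBethCompanion ι K M,
        BethComp.StrongBeth M,
        BethComp.StrongES M,
        ∀ n, ∀ f ∈ BethComp.impPP K n,
          ∃ T : Set (L'.Term (Fin n)), BethComp.InterpolatedIn ι M f T] ∧
    (BethComp.IsQuasivariety K →
      List.TFAE
        [BethComp.IsBethCompanion ι K M,
          BethComp.StrongBeth M,
          BethComp.StrongES M,
          ∀ n, ∀ f ∈ BethComp.impPP K n,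
            ∃ T : Set (L'.Term (Fin n)), BethComp.InterpolatedIn ι M f T,
          ∀ n, ∀ f ∈ BethComp.impPP K n,
            ∃ t : L'.Term (Fin n), BethComp.InterpolatedIn ι M f {t}]) := by
  obtain ⟨hι, F, hF, g, rfl⟩ := id hM
  have hred : ∀ A ∈ BethComp.subClass (BethComp.expandedClass ι K F g), A.reduct ι ∈ K :=
    fun A hA => hK.reduct_mem hA
  have hbase : List.TFAE
      [BethComp.IsBethCompanion ι K (BethComp.subClass (BethComp.expandedClass ι K F g)),
        BethComp.StrongBeth (BethComp.subClass (BethComp.expandedClass ι K F g)),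
        BethComp.StrongES (BethComp.subClass (BethComp.expandedClass ι K F g)),
        ∀ n, ∀ f ∈ BethComp.impPP K n, ∃ T : Set (L'.Term (Fin n)),
          BethComp.InterpolatedIn ι (BethComp.subClass (BethComp.expandedClass ι K F g)) f T] := by
    tfae_have 1 → 4 := fun h n f hf => h.2 n f hf.1
    tfae_have 4 → 3 := BethComp.strongES_of_interpolatedIn hK hι hF
    tfae_have 3 → 2 := BethComp.StrongES.strongBeth fun B S hS hB =>
      BethComp.subClass_of_embedding hB S.subtype
    tfae_have 2 → 1 := fun h => ⟨hM, fun n f hf => h.exists_interpolatedIn hred hf⟩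
    tfae_finish
  refine ⟨hbase, fun hQ => ?_⟩
  tfae_have 1 ↔ 2 := hbase.out 0 1
  tfae_have 1 ↔ 3 := hbase.out 0 2
  tfae_have 1 ↔ 4 := hbase.out 0 3
  tfae_have 4 → 5 := fun h n f hf =>
    BethComp.exists_interpolatedIn_singleton hQ hF hf (h n f hf).choose_spec
  tfae_have 5 → 4 := fun h n f hf => ⟨_, (h n f hf).choose_spec⟩
  tfae_finish
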